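/- **Definitions.** Let $r,q\ge 1$ be integers and put $s=\lceil r/2\rceil$. Let $\mathcal N^r_q=\{\mathbf a=(a_1,\dots,a_q)\in\mathbb Z_{\ge0}^q : a_1+\dots+a_q=r\}$ and $B^r=\{\mathbf a\in\mathcal N^r_q : a_i\le s \text{ for all } i\}$. For $i\in\{1,\dots,q\}$ let $$F^r_i=\{\mathbf a\in\mathcal N^r_q : a_i\le\max\{r-1,s\},\ a_j\le s\text{ for } j\ne i\},\qquad G^r_i=\{\mathbf a\in\mathcal N^r_q : a_i\ge r-1\}.$$ Let $\mathbb L^r_q$ be the simplicial complex on the vertex set $\mathcal N^r_q$ whose faces are all subsets of the sets $F^r_1,\dots,F^r_q,G^r_1,\dots,G^r_q$; it depends only on $r$ and $q$. Let $S=\mathsf k[x_1,\dots,x_n]$ be a polynomial ring over a field $\mathsf k$ and let $I\subseteq S$ be an ideal minimally generated by monomials $m_1,\dots,m_q$. Put $\mathbf m^{\mathbf a}=m_1^{a_1}\cdots m_q^{a_q}$ for $\mathbf a\in\mathcal N^r_q$. Choose one representative from each class of the equivalence relation $\mathbf a\sim\mathbf b\iff \mathbf m^{\mathbf a}=\mathbf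 m^{\mathbf b}$ on $\mathcal N^r_q$, where a class that meets $B^r$ must be represented by an element of $B^r$. From the resulting set $\{\mathbf c_1,\dots,\mathbf c_t\}$ eliminate every $\mathbf c_i$ for which $\mathbf m^{\mathbf c_j}\mid\mathbf m^{\mathbf c_i}$ for some $j\ne i$. Then $\mathbb L^r(I)$ denotes the induced subcomplex of $\mathbb L^r_q$ on the set of remaining points (for some such choice of representatives). Let $\Delta$ be a finite simplicial complex whose vertices $v$ are labeled by monomials $M_v$ of $S$ and are totally ordered. For a face $\sigma$ let $M_\sigma=\mathrm{lcm}(M_v : v\in\sigma)$. For $t\ge0$ let $(\mathbb F_\Delta)_t$ be the free $S$-module with basis elements $e_\sigma$ in multidegree $M_\sigma$, for the faces $\sigma$ of $\Delta$ with $t+1$ vertices; for a face $\sigma=\{v_0<\dots<v_t\}$ with $t\ge1$ put $$\partial(e_\sigma)=\sum_{j=0}^t(-1)^j\,\frac{M_\sigma}{M_{\sigma\setminus\{v_j\}}}\,e_{\sigma\setminus\{v_j\}},$$ and let $(\mathbb F_\Delta)_0\to S$ map $e_{\{v\}}$ to $M_v$. One says that $\Delta$ *supports a free resolution* of an ideal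 $J$ of $S$ if this is a multigraded free resolution of $J$, that is, if the maps preserve multidegrees, the image of $(\mathbb F_\Delta)_0\to S$ is $J$, and the sequence $\cdots\to(\mathbb F_\Delta)_1\to(\mathbb F_\Delta)_0\to J\to0$ is exact. **Theorem.** Let $q\ge1$, let $I$ be an ideal of $S$ minimally generated by square-free monomials $m_1,\dots,m_q$, and let $r\ge1$. Label each vertex $\mathbf a$ of the complexes below with the monomial $\mathbf m^{\mathbf a}$, and fix any total order on $\mathcal N^r_q$. Then: 1. $\mathbb L^r_q$ supports a free resolution of $I^r$; 2. $\mathbb L^r(I)$ supports a free resolution of $I^r$, for every choice of representatives in its construction. -/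

import Mathlib

namespace PowerResolution

open MvPolynomial

noncomputable section

/-! ### Free resolutions -/

/-- The complex `⋯ → F 2 → F 1 → F 0 → I → 0` is a free resolution of the ideal `I` of `S`:
all `F t` are free of finite rank, only finitely many of them are nonzero, and the sequence is
exact.  The augmentation `ε` is written as a map to `S`, whose image is required to be `I`. -/
structure IsFreeResolution {S : Type*} [CommRing S] (I : Ideal S)
    (F : ℕ → Type*) [∀ t, AddCommGroup (F t)] [∀ t, Module S (F t)]
    (d : ∀ t, F (t + 1) →ₗ[S] F t) (ε : F 0 →ₗ[S] S) : Prop where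
  free : ∀ t, Module.Free S (F t)
  finite : ∀ t, Module.Finite S (F t)
  bounded : ∃ N, ∀ t, N ≤ t → Subsingleton (F t)
  exact_succ : ∀ t, Function.Exact (d (t + 1)) (d t)
  exact_zero : Function.Exact (d 0) ε
  range_eq : LinearMap.range ε = I

/-! ### Monomials

The monomial `x₁ ^ w₁ ⋯ xₙ ^ wₙ` is represented by its exponent vector `w : Fin n →₀ ℕ`.  For
exponent vectors `v` and `w`: the monomial of `v` divides the one of `w` iff `v ≤ w`, the lcm of
the two monomials has exponent vector `v ⊔ w`, and, if `v ≤ w`, the quotient of the second one by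
the first one has exponent vector `w - v`. -/

/-- The polynomial `x ^ w`. -/
def mono (k : Type*) [Field k] {n : ℕ} (w : Fin n →₀ ℕ) : MvPolynomial (Fin n) k :=
  monomial w 1

/-- The monomial with exponent vector `w` is square-free: no variable divides it twice. -/
def IsSquarefreeMonomial {n : ℕ} (w : Fin n →₀ ℕ) : Prop :=
  ∀ x, w x ≤ 1

/-- The family `g` generates `I` and no proper subfamily does. -/
def IsMinimallyGeneratedBy {S ι : Type*} [CommRing S] (I : Ideal S) (g : ι → S) : Prop :=
  Ideal.span (Set.range g) = I ∧ ∀ J : Set ι, Ideal.span (g '' J) = I → J = Set.univ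

/-! ### The homogenized chain complex of a labelled simplicial complex -/

section Homogenization

variable (k : Type*) [Field k] {n : ℕ} {V : Type*}

/-- The label `M_σ` of a face: the lcm of the labels of its vertices. -/
def faceLabel (label : V → (Fin n →₀ ℕ)) (σ : Finset V) : Fin n →₀ ℕ :=
  σ.sup label

/-- The faces of dimension `t`, that is, with `t + 1` vertices. -/
abbrev FaceOfDim (Δ : PreAbstractSimplicialComplex V) (t : ℕ) : Type _ :=
  {σ : Finset V // σ ∈ Δ.faces ∧ σ.card = t + 1}

/-- The free module over `k[x₁, …, xₙ]` with basis `e_σ`, where `σ` runs over the faces with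
`t + 1` vertices. -/
abbrev Chains (n : ℕ) (Δ : PreAbstractSimplicialComplex V) (t : ℕ) : Type _ :=
  FaceOfDim Δ t →₀ MvPolynomial (Fin n) k

/-- An element `∑ f_σ e_σ` is homogeneous of multidegree `w`, where `e_σ` has multidegree
`M_σ`. -/
def IsMultihomogeneous {Δ : PreAbstractSimplicialComplex V} {t : ℕ}
    (label : V → (Fin n →₀ ℕ)) (w : Fin n →₀ ℕ) (f : Chains k n Δ t) : Prop :=
  ∀ σ, ∀ e ∈ (f σ).support, e + faceLabel label σ.1 = w

variable [LinearOrder V]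

/-- The facet of the face `σ` that is opposite to its vertex `v`. -/
def FaceOfDim.erase {Δ : PreAbstractSimplicialComplex V} {t : ℕ} (σ : FaceOfDim Δ (t + 1)) (v : V)
    (hv : v ∈ σ.1) : FaceOfDim Δ t :=
  ⟨σ.1.erase v, by
    have hc : (σ.1.erase v).card = t + 1 := by
      rw [Finset.card_erase_of_mem hv, σ.2.2]; rfl
    exact ⟨(Δ.isRelLowerSet_faces σ.2.1).2 (Finset.erase_subset v σ.1)
      (Finset.card_pos.mp (by omega)), hc⟩⟩

/-- The differential `∂ e_σ = ∑ⱼ (-1) ^ j (M_σ / M_{σ \ vⱼ}) e_{σ \ vⱼ}`, where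
`σ = {v₀ < v₁ < ⋯}`; the position `j` of `v` in `σ` is the number of vertices of `σ` that are
smaller than `v`. -/
def differential (Δ : PreAbstractSimplicialComplex V) (label : V → (Fin n →₀ ℕ)) (t : ℕ) :
    Chains k n Δ (t + 1) →ₗ[MvPolynomial (Fin n) k] Chains k n Δ t :=
  Finsupp.linearCombination (MvPolynomial (Fin n) k) fun σ =>
    ∑ v ∈ σ.1.attach,
      Finsupp.single (σ.erase v.1 v.2)
        ((-1) ^ (σ.1.filter (· < v.1)).card *
          mono k (faceLabel label σ.1 - faceLabel label (σ.1.erase v.1)))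

/-- The augmentation, which sends `e_v` to the monomial that labels the vertex `v`. -/
def augmentation (Δ : PreAbstractSimplicialComplex V) (label : V → (Fin n →₀ ℕ)) :
    Chains k n Δ 0 →ₗ[MvPolynomial (Fin n) k] MvPolynomial (Fin n) k :=
  Finsupp.linearCombination (MvPolynomial (Fin n) k) fun σ => mono k (faceLabel label σ.1)

/-- The simplicial complex `Δ`, whose vertices are labelled by monomials, supports a free
resolution of `I`: the homogenization of its chain complex is a multigraded free resolution
of `I`. -/
structure SupportsFreeResolution (Δ : PreAbstractSimplicialComplex V)
    (label : V → (Fin n →₀ ℕ)) (I : Ideal (MvPolynomial (Fin n) k)) : Prop where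
  isFreeResolution :
    IsFreeResolution I (Chains k n Δ) (differential k Δ label) (augmentation k Δ label)
  differential_homogeneous : ∀ (t : ℕ) (w : Fin n →₀ ℕ) (f : Chains k n Δ (t + 1)),
    IsMultihomogeneous k label w f → IsMultihomogeneous k label w (differential k Δ label t f)
  augmentation_homogeneous : ∀ (w : Fin n →₀ ℕ) (f : Chains k n Δ 0),
    IsMultihomogeneous k label w f → ∀ e ∈ (augmentation k Δ label f).support, e = w

end Homogenization

/-! ### The simplicial complexes -/

/-- The set of all `(a₁, …, a_q)` with nonnegative integers `aᵢ` whose sum is `r`. -/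
@[ext]
structure Points (r q : ℕ) : Type where
  coord : Fin q → ℕ
  sum_coord : ∑ i, coord i = r

/-- `s = ⌈r / 2⌉`. -/
def half (r : ℕ) : ℕ := (r + 1) / 2

/-- `Fᵢ`: the points with `aᵢ ≤ max (r - 1) s` and `aⱼ ≤ s` for `j ≠ i`. -/
def firstLayer (r q : ℕ) (i : Fin q) : Set (Points r q) :=
  {a | a.coord i ≤ max (r - 1) (half r) ∧ ∀ j, j ≠ i → a.coord j ≤ half r}

/-- `Gᵢ`: the points with `aᵢ ≥ r - 1`. -/
def secondLayer (r q : ℕ) (i : Fin q) : Set (Points r q) :=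
  {a | r - 1 ≤ a.coord i}

/-- `B`: the points with all coordinates at most `s`. -/
def base (r q : ℕ) : Set (Points r q) :=
  {a | ∀ i, a.coord i ≤ half r}

/-- The complex `𝕃 r q`, whose faces are the subsets of the sets `Fᵢ` and `Gᵢ`. -/
def complexL (r q : ℕ) : PreAbstractSimplicialComplex (Points r q) where
  faces := {σ | σ.Nonempty ∧
    ∃ i, (σ : Set (Points r q)) ⊆ firstLayer r q i ∨ (σ : Set (Points r q)) ⊆ secondLayer r q i}
  isRelLowerSet_faces := by
    rintro σ ⟨hσ, i, h⟩
    refine ⟨hσ, fun τ hτ hne => ⟨hne, i, ?_⟩⟩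
    have hτ' : (τ : Set (Points r q)) ⊆ σ := Finset.coe_subset.mpr hτ
    exact h.imp hτ'.trans hτ'.trans

/-- The induced subcomplex of `Δ` on the vertex set `W`. -/
def inducedSubcomplex {V : Type*} (Δ : PreAbstractSimplicialComplex V) (W : Set V) :
    PreAbstractSimplicialComplex V where
  faces := {σ | σ ∈ Δ.faces ∧ (σ : Set V) ⊆ W}
  isRelLowerSet_faces := by
    rintro σ ⟨hσ, h⟩
    have hΔ := Δ.isRelLowerSet_faces hσ
    exact ⟨hΔ.1, fun τ hτ hne => ⟨hΔ.2 hτ hne, (Finset.coe_subset.mpr hτ).trans h⟩⟩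

section Labels

variable {n q r : ℕ}

/-- The exponent vector of the monomial `m ^ a = m₁ ^ a₁ ⋯ m_q ^ a_q`. -/
def powerLabel (m : Fin q → (Fin n →₀ ℕ)) (a : Points r q) : Fin n →₀ ℕ :=
  ∑ i, a.coord i • m i

/-- `C` consists of one representative of each class of the relation `m ^ a = m ^ b`, and a class
that meets the base is represented by a point of the base. -/
structure IsRepresentativeSet (m : Fin q → (Fin n →₀ ℕ)) (C : Set (Points r q)) : Prop where
  existsUnique : ∀ a : Points r q, ∃! c, c ∈ C ∧ powerLabel m c = powerLabel m a
  mem_base : ∀ c ∈ C, (∃ b ∈ base r q, powerLabel m b = powerLabel m c) → c ∈ base r q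

/-- The points of `C` that remain after eliminating each `c` such that `m ^ c'` divides `m ^ c`
for some other point `c'` of `C`. -/
def nonredundant (m : Fin q → (Fin n →₀ ℕ)) (C : Set (Points r q)) : Set (Points r q) :=
  {c | c ∈ C ∧ ¬ ∃ c' ∈ C, c' ≠ c ∧ powerLabel m c' ≤ powerLabel m c}

/-- The complex `𝕃 r (I)`, where `I` is minimally generated by the monomials `m`, formed with the
set `C` of representatives. -/
def complexLOf (m : Fin q → (Fin n →₀ ℕ)) (C : Set (Points r q)) :
    PreAbstractSimplicialComplex (Points r q) :=
  inducedSubcomplex (complexL r q) (nonredundant m C)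

/-- A choice of representatives is always possible. -/
theorem exists_isRepresentativeSet (m : Fin q → (Fin n →₀ ℕ)) :
    ∃ C : Set (Points r q), IsRepresentativeSet m C := by
  classical
  have key : ∀ w : Set.range (powerLabel (r := r) m), ∃ c : Points r q, powerLabel m c = w.1 ∧
      ((∃ b ∈ base r q, powerLabel m b = w.1) → c ∈ base r q) := by
    rintro ⟨w, a, rfl⟩
    by_cases h : ∃ b ∈ base r q, powerLabel m b = powerLabel m a
    · obtain ⟨b, hb, hba⟩ := h
      exact ⟨b, hba, fun _ => hb⟩
    · exact ⟨a, rfl, fun h' => absurd h' h⟩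
  choose f hf hfb using key
  refine ⟨Set.range f, fun a => ⟨f ⟨_, a, rfl⟩, ⟨⟨_, rfl⟩, hf _⟩, ?_⟩, ?_⟩
  · rintro _ ⟨⟨w, rfl⟩, h⟩
    have : w = ⟨powerLabel m a, a, rfl⟩ := Subtype.ext ((hf w).symm.trans h)
    rw [this]
  · rintro _ ⟨w, rfl⟩ h
    exact hfb w (by rwa [hf w] at h)

end Labels

end

end PowerResolution

/-! Multiplying each coefficient of a chain by the label of its face turns the differential into the
ordinary simplicial boundary, so exactness can be tested one multidegree at a time (the
Bayer–Sturmfels criterion, `supportsFreeResolution_of_isAcyclicFamily`): for each `w` that bounds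
the label of some face, the faces with label at most `w` must form an acyclic complex. Both
complexes of the theorem are induced on a vertex set `N` such that every `m ^ a` is divisible by a
label from `N`, and `isAcyclicFamily_boundedFaces` treats all such `N` at once.

Fix `w`. A corner `r eᵢ` with `r ≥ 2` lies in the facet `Gᵢ` only, so every non-corner of `Gᵢ`
dominates it. `exists_mem_secondLayer` supplies one unless the corner is the only vertex below `w`,
and then it suffices to treat the complex without corners. There every face lies in some `Fᵢ`. A
vertex in the base belongs to all `Fᵢ` and is a cone apex. If there is none, each vertex has exactly
one coordinate above `s`; by `exists_mem_base` two vertices cannot have it in different places, so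
all vertices lie in a single `Fᵢ` and span a simplex.

Square-freeness bounds the exponent of a variable `x` in `m ^ a` by `r - aᵢ` when `x` does not
divide `mᵢ`. Minimality of the generators provides variables that divide one generator and not
another; they make the descents strict. -/

namespace PowerResolution

open Finset MvPolynomial
open scoped Pointwise

/-! ### Simplicial chains as functions on finite sets: cones, dominated vertices, acyclicity. -/

section SimplicialChains

variable {V : Type*} [LinearOrder V]

/-- The sign `(-1) ^ j`, where `j` is the number of elements of `σ` that are smaller than `v`. -/
def vertexSign (A : Type*) [CommRing A] (v : V) (σ : Finset V) : A :=
  ∏ x ∈ σ, if x < v then -1 else 1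

theorem vertexSign_eq_pow (A : Type*) [CommRing A] (v : V) (σ : Finset V) :
    vertexSign A v σ = (-1) ^ (σ.filter (· < v)).card := by
  rw [vertexSign, Finset.prod_ite]
  simp

theorem vertexSign_insert (A : Type*) [CommRing A] {u v : V} {σ : Finset V} (hu : u ∉ σ) :
    vertexSign A v (insert u σ) = (if u < v then -1 else 1) * vertexSign A v σ :=
  Finset.prod_insert hu

theorem vertexSign_insert_self (A : Type*) [CommRing A] (v : V) (σ : Finset V) :
    vertexSign A v (insert v σ) = vertexSign A v σ := by
  by_cases h : v ∈ σ
  · rw [Finset.insert_eq_of_mem h]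
  · simp [vertexSign_insert A h]

theorem vertexSign_mul_self (A : Type*) [CommRing A] (v : V) (σ : Finset V) :
    vertexSign A v σ * vertexSign A v σ = 1 := by
  rw [vertexSign_eq_pow, ← pow_add, ← two_mul, pow_mul]
  simp

theorem vertexSign_mul_insert (A : Type*) [CommRing A] {u v : V} {σ : Finset V} (hu : u ∉ σ)
    (hv : v ∉ σ) (huv : u ≠ v) :
    vertexSign A v (insert u σ) * vertexSign A u σ =
      -(vertexSign A u (insert v σ) * vertexSign A v σ) := by
  rw [vertexSign_insert A hu, vertexSign_insert A hv]
  rcases lt_or_gt_of_ne huv with h | h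
  · simp [h, h.not_gt, mul_comm]
  · simp [h, h.not_gt, mul_comm]

variable {A : Type*} [CommRing A]

/-- The cone operator with apex `u`. -/
def cone (u : V) (f : Finset V → A) (σ : Finset V) : A :=
  if u ∈ σ then vertexSign A u σ * f (σ.erase u) else 0

theorem cone_ne_zero {u : V} {f : Finset V → A} {σ : Finset V} (h : cone u f σ ≠ 0) :
    u ∈ σ ∧ f (σ.erase u) ≠ 0 := by
  rw [cone] at h
  split_ifs at h with hu
  · exact ⟨hu, right_ne_zero_of_mul h⟩
  · exact absurd rfl h

variable [Fintype V]

/-- The boundary of an augmented simplicial chain, written as a function on all finite sets. -/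
def boundary (f : Finset V → A) (τ : Finset V) : A :=
  ∑ v ∈ τᶜ, vertexSign A v τ * f (insert v τ)

theorem boundary_sub (f g : Finset V → A) : boundary (f - g) = boundary f - boundary g := by
  funext τ
  simp [boundary, mul_sub, Finset.sum_sub_distrib]

theorem boundary_add (f g : Finset V → A) : boundary (f + g) = boundary f + boundary g := by
  funext τ
  simp [boundary, mul_add, Finset.sum_add_distrib]

theorem boundary_zero : boundary (0 : Finset V → A) = 0 := by
  funext τ
  simp [boundary]

theorem exists_of_boundary_ne_zero {f : Finset V → A} {τ : Finset V} (h : boundary f τ ≠ 0) :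
    ∃ v, v ∉ τ ∧ f (insert v τ) ≠ 0 := by
  obtain ⟨v, hv, hne⟩ := Finset.exists_ne_zero_of_sum_ne_zero h
  exact ⟨v, by simpa using hv, right_ne_zero_of_mul hne⟩

/-- Adding `u` then `v` and adding `v` then `u` contribute opposite signs, so swapping the pair
cancels the double sum. -/
theorem boundary_boundary (f : Finset V → A) : boundary (boundary f) = 0 := by
  funext τ
  simp only [boundary, Pi.zero_apply, Finset.mul_sum]
  rw [Finset.sum_sigma']
  refine Finset.sum_involution (fun p _ => ⟨p.2, p.1⟩) ?_ ?_ ?_ ?_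
  · rintro ⟨u, v⟩ hp
    simp only [Finset.mem_sigma, Finset.mem_compl, Finset.mem_insert, not_or] at hp
    obtain ⟨hu, hvu, hv⟩ := hp
    rw [← mul_assoc, ← mul_assoc, mul_comm (vertexSign A u τ), mul_comm (vertexSign A v τ),
      vertexSign_mul_insert A hu hv (Ne.symm hvu), Finset.insert_comm]
    ring
  · rintro ⟨u, v⟩ hp - heq
    simp only [Finset.mem_sigma, Finset.mem_compl, Finset.mem_insert, not_or] at hp
    simp only [Sigma.mk.injEq] at heq
    exact hp.2.1 heq.1
  · rintro ⟨u, v⟩ hp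
    simp only [Finset.mem_sigma, Finset.mem_compl, Finset.mem_insert, not_or] at hp ⊢
    exact ⟨hp.2.2, fun h => hp.2.1 h.symm, hp.1⟩
  · rintro ⟨u, v⟩ hp
    rfl

/-- The cone operator is a contracting homotopy of the augmented complex of the full simplex. -/
theorem boundary_cone_add_cone_boundary (u : V) (f : Finset V → A) :
    boundary (cone u f) + cone u (boundary f) = f := by
  funext σ
  simp only [Pi.add_apply]
  by_cases hu : u ∈ σ
  · obtain ⟨τ, hτ, rfl⟩ : ∃ τ, u ∉ τ ∧ insert u τ = σ :=
      ⟨σ.erase u, Finset.notMem_erase u σ, Finset.insert_erase hu⟩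
    have hcompl : τᶜ = insert u (insert u τ)ᶜ := by
      ext x
      by_cases hx : x = u <;> simp [hx, hτ]
    have hcone : cone u (boundary f) (insert u τ) = f (insert u τ) +
        ∑ v ∈ (insert u τ)ᶜ, vertexSign A u τ * (vertexSign A v τ * f (insert v τ)) := by
      rw [cone, if_pos (Finset.mem_insert_self u τ), Finset.erase_insert hτ,
        vertexSign_insert_self, boundary, hcompl, Finset.sum_insert (by simp), mul_add,
        ← mul_assoc, vertexSign_mul_self, one_mul, Finset.mul_sum]
    rw [hcone, boundary, add_left_comm, ← Finset.sum_add_distrib, Finset.sum_eq_zero, add_zero]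
    intro v hv
    simp only [Finset.mem_compl, Finset.mem_insert, not_or] at hv
    rw [cone, if_pos (by simp), Finset.insert_comm v u, Finset.erase_insert (by
      simp [hτ, Ne.symm hv.1]), vertexSign_insert_self, ← mul_assoc, ← mul_assoc]
    rw [vertexSign_insert A hτ, vertexSign_insert A hv.2]
    rcases lt_or_gt_of_ne hv.1 with h | h
    · simp [h, h.not_gt]
      ring
    · simp [h, h.not_gt]
      ring
  · rw [cone, if_neg hu, add_zero, boundary,
      Finset.sum_eq_single_of_mem u (by simpa using hu)]
    · rw [cone, if_pos (Finset.mem_insert_self u σ), Finset.erase_insert hu,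
        vertexSign_insert_self, ← mul_assoc, vertexSign_mul_self, one_mul]
    · intro v _ hvu
      rw [cone, if_neg (by simp [hu, Ne.symm hvu]), mul_zero]

/-- The augmented chain complex over `A` of the family `K` of finite sets is exact. -/
def IsAcyclicFamily (A : Type*) [CommRing A] (K : Set (Finset V)) : Prop :=
  ∀ (t : ℕ) (f : Finset V → A), (∀ σ, f σ ≠ 0 → σ ∈ K ∧ σ.card = t) → boundary f = 0 →
    ∃ g : Finset V → A, (∀ σ, g σ ≠ 0 → σ ∈ K ∧ σ.card = t + 1) ∧ boundary g = f

theorem isAcyclicFamily_of_apex {K : Set (Finset V)} (u : V) (hK : ∀ σ ∈ K, insert u σ ∈ K) :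
    IsAcyclicFamily A K := by
  intro t f hf hf0
  refine ⟨cone u f, fun σ hσ => ?_, ?_⟩
  · obtain ⟨hu, hne⟩ := cone_ne_zero hσ
    obtain ⟨hmem, hcard⟩ := hf _ hne
    refine ⟨Finset.insert_erase hu ▸ hK _ hmem, ?_⟩
    rw [← hcard, Finset.card_erase_add_one hu]
  · have h := boundary_cone_add_cone_boundary u f
    have h0 : cone u (0 : Finset V → A) = 0 := by
      funext σ
      simp [cone]
    rwa [hf0, h0, add_zero] at h

/-- Any cycle can be pushed off `v`. Let `f₁` be the part of the cycle `f` on faces containing `v`;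
coning it from `u` stays in `K` by domination. Since `∂f₁` agrees with `∂f = 0` on sets containing
`v`, the homotopy formula shows that `f - ∂(cone u f₁)` lives on faces avoiding `v`. -/
theorem IsAcyclicFamily.of_dominated {K : Set (Finset V)} (hK : IsLowerSet K) {u v : V}
    (huv : u ≠ v) (hdom : ∀ σ ∈ K, v ∈ σ → insert u σ ∈ K)
    (hacyc : IsAcyclicFamily A {σ | σ ∈ K ∧ v ∉ σ}) : IsAcyclicFamily A K := by
  intro t f hf hf0
  set f₁ : Finset V → A := fun σ => if v ∈ σ then f σ else 0 with hf₁
  have hf₁ne : ∀ {σ}, f₁ σ ≠ 0 → v ∈ σ ∧ f σ ≠ 0 := by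
    intro σ h
    simp only [hf₁] at h
    split_ifs at h with hv
    · exact ⟨hv, h⟩
    · exact absurd rfl h
  have hbd : ∀ {τ}, boundary f₁ τ ≠ 0 → v ∉ τ ∧ f (insert v τ) ≠ 0 := by
    intro τ h
    have hv : v ∉ τ := by
      intro hv
      apply h
      have : boundary f₁ τ = boundary f τ :=
        Finset.sum_congr rfl fun x _ => by simp [hf₁, hv]
      rw [this, hf0, Pi.zero_apply]
    obtain ⟨x, hx, hne⟩ := exists_of_boundary_ne_zero h
    obtain ⟨hvx, hne'⟩ := hf₁ne hne
    obtain rfl : v = x := by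
      rcases Finset.mem_insert.mp hvx with h | h
      · exact h
      · exact absurd h hv
    exact ⟨hv, hne'⟩
  have heq : f - boundary (cone u f₁) = (f - f₁) + cone u (boundary f₁) := by
    have := boundary_cone_add_cone_boundary u f₁
    nth_rewrite 2 [← this]
    abel
  obtain ⟨g, hg, hgf⟩ := hacyc t (f - boundary (cone u f₁)) (fun σ hσ => by
    rw [heq] at hσ
    by_cases h0 : (f - f₁) σ = 0
    · rw [Pi.add_apply, h0, zero_add] at hσ
      obtain ⟨huσ, hne⟩ := cone_ne_zero hσ
      obtain ⟨hv, hne'⟩ := hbd hne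
      obtain ⟨hmem, hcard⟩ := hf _ hne'
      refine ⟨⟨hK ?_ (hdom _ hmem (Finset.mem_insert_self _ _)), fun hvσ => ?_⟩, ?_⟩
      · intro x hx
        by_cases hxu : x = u <;> simp [hxu, hx]
      · exact hv (Finset.mem_erase.mpr ⟨huv.symm, hvσ⟩)
      · rw [Finset.card_insert_of_notMem hv, Finset.card_erase_add_one huσ] at hcard
        exact hcard
    · have hv : v ∉ σ := fun hv => h0 (by simp [hf₁, hv])
      have hne : f σ ≠ 0 := by simpa [hf₁, hv] using h0
      exact ⟨⟨(hf σ hne).1, hv⟩, (hf σ hne).2⟩)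
    (by rw [boundary_sub, boundary_boundary, hf0, sub_zero])
  refine ⟨g + cone u f₁, fun σ hσ => ?_, ?_⟩
  · by_cases h0 : g σ = 0
    · rw [Pi.add_apply, h0, zero_add] at hσ
      obtain ⟨huσ, hne⟩ := cone_ne_zero hσ
      obtain ⟨hv, hne'⟩ := hf₁ne hne
      obtain ⟨hmem, hcard⟩ := hf _ hne'
      refine ⟨Finset.insert_erase huσ ▸ hdom _ hmem hv, ?_⟩
      rw [← hcard, Finset.card_erase_add_one huσ]
    · exact ⟨(hg σ h0).1.1, (hg σ h0).2⟩
  · rw [boundary_add, hgf, sub_add_cancel]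

/-- The dominating vertices lie outside `T`, so they survive all deletions and the vertices of `T`
can be removed one by one. -/
theorem IsAcyclicFamily.of_forall_dominated {K : Set (Finset V)} (hK : IsLowerSet K)
    (T : Finset V)
    (hdom : ∀ v ∈ T, ∃ u, u ∉ T ∧ ∀ σ ∈ K, v ∈ σ → insert u σ ∈ K)
    (hacyc : IsAcyclicFamily A {σ | σ ∈ K ∧ ∀ v ∈ T, v ∉ σ}) : IsAcyclicFamily A K := by
  induction T using Finset.induction_on generalizing K with
  | empty => simpa using hacyc
  | insert v T hv ih =>
    obtain ⟨u, hu, hdu⟩ := hdom v (Finset.mem_insert_self v T)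
    have huv : u ≠ v := fun h => hu (h ▸ Finset.mem_insert_self v T)
    refine IsAcyclicFamily.of_dominated hK huv hdu (ih ?_ ?_ ?_)
    · exact fun σ τ hτ hσ => ⟨hK hτ hσ.1, fun h => hσ.2 (hτ h)⟩
    · intro x hx
      obtain ⟨y, hy, hdy⟩ := hdom x (Finset.mem_insert_of_mem hx)
      refine ⟨y, fun h => hy (Finset.mem_insert_of_mem h), fun σ hσ hxσ =>
        ⟨hdy σ hσ.1 hxσ, fun h => ?_⟩⟩
      rcases Finset.mem_insert.mp h with rfl | h
      · exact hy (Finset.mem_insert_self _ _)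
      · exact hσ.2 h
    · convert hacyc using 1
      ext σ
      simp [and_assoc]

end SimplicialChains

/-! ### Reduction of exactness to acyclicity in each multidegree. -/

section Dehomogenization

variable {V : Type*} [LinearOrder V] {A : Type*} [CommRing A]

theorem boundary_single [Fintype V] (σ : Finset V) (a : A) :
    boundary (Pi.single σ a) =
      ∑ v ∈ σ, Pi.single (σ.erase v) (vertexSign A v σ * a) := by
  funext τ
  rw [Finset.sum_apply, boundary]
  have h1 : ∀ v ∈ σ, v ∉ τᶜ →
      (Pi.single (σ.erase v) (vertexSign A v σ * a) : Finset V → A) τ = 0 := by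
    intro v _ hv
    rw [Pi.single_apply, if_neg]
    rintro rfl
    simp at hv
  have h2 : ∀ v ∈ τᶜ, v ∉ σ →
      vertexSign A v τ * (Pi.single σ a : Finset V → A) (insert v τ) = 0 := by
    intro v _ hv
    rw [Pi.single_apply, if_neg, mul_zero]
    rintro rfl
    simp at hv
  rw [← Finset.sum_subset (Finset.inter_subset_left (s₁ := σ) (s₂ := τᶜ)),
    ← Finset.sum_subset (Finset.inter_subset_right (s₁ := σ) (s₂ := τᶜ))]
  · refine Finset.sum_congr rfl fun v hv => ?_
    obtain ⟨hvσ, hvτ⟩ := Finset.mem_inter.mp hv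
    rw [Finset.mem_compl] at hvτ
    by_cases h : insert v τ = σ
    · subst h
      rw [Finset.erase_insert hvτ, Pi.single_eq_same, Pi.single_eq_same, vertexSign_insert_self]
    · rw [Pi.single_eq_of_ne h, Pi.single_eq_of_ne, mul_zero]
      rintro rfl
      exact h (Finset.insert_erase hvσ)
  · intro v hv hv'
    exact h2 v hv fun h => hv' (Finset.mem_inter.mpr ⟨h, hv⟩)
  · intro v hv hv'
    exact h1 v hv fun h => hv' (Finset.mem_inter.mpr ⟨hv, h⟩)

variable {k : Type*} [Field k] {n t : ℕ} {Δ : PreAbstractSimplicialComplex V}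

open Classical in
/-- The chain `∑ f_σ e_σ` as the function `σ ↦ M_σ f_σ` on all finite sets. -/
noncomputable def dehomogenize (label : V → (Fin n →₀ ℕ)) :
    Chains k n Δ t →ₗ[MvPolynomial (Fin n) k] (Finset V → MvPolynomial (Fin n) k) where
  toFun f σ := if h : σ ∈ Δ.faces ∧ σ.card = t + 1 then
    mono k (faceLabel label σ) * f ⟨σ, h⟩ else 0
  map_add' f g := by
    funext σ
    by_cases h : σ ∈ Δ.faces ∧ σ.card = t + 1 <;> simp [h, mul_add]
  map_smul' c f := by
    funext σ
    by_cases h : σ ∈ Δ.faces ∧ σ.card = t + 1 <;> simp [h, mul_left_comm]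

variable {label : V → (Fin n →₀ ℕ)}

omit [LinearOrder V] in
theorem dehomogenize_face (f : Chains k n Δ t) (σ : FaceOfDim Δ t) :
    dehomogenize label f σ.1 = mono k (faceLabel label σ.1) * f σ :=
  dif_pos σ.2

omit [LinearOrder V] in
theorem mem_of_dehomogenize_ne_zero {f : Chains k n Δ t} {σ : Finset V}
    (h : dehomogenize label f σ ≠ 0) : σ ∈ Δ.faces ∧ σ.card = t + 1 := by
  by_contra hσ
  exact h (dif_neg hσ)

theorem dehomogenize_single (σ : FaceOfDim Δ t) (c : MvPolynomial (Fin n) k) :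
    dehomogenize label (Finsupp.single σ c) =
      Pi.single σ.1 (mono k (faceLabel label σ.1) * c) := by
  funext τ
  by_cases h : τ = σ.1
  · subst h
    rw [dehomogenize_face, Pi.single_eq_same, Finsupp.single_eq_same]
  · rw [Pi.single_eq_of_ne h]
    by_contra hne
    have hτ := mem_of_dehomogenize_ne_zero hne
    refine hne ((dehomogenize_face (label := label) (Finsupp.single σ c) ⟨τ, hτ⟩).trans ?_)
    rw [Finsupp.single_eq_of_ne (fun h' => h (congrArg Subtype.val h')), mul_zero]

theorem mono_ne_zero (w : Fin n →₀ ℕ) : mono k w ≠ 0 := by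
  simp [mono]

omit [LinearOrder V] in
theorem dehomogenize_injective :
    Function.Injective (dehomogenize (k := k) (Δ := Δ) (t := t) label) := by
  intro f g h
  ext1 σ
  have := congrFun h σ.1
  rw [dehomogenize_face, dehomogenize_face] at this
  exact mul_left_cancel₀ (mono_ne_zero _) this

theorem mono_mul_mono_sub {v w : Fin n →₀ ℕ} (h : v ≤ w) :
    mono k v * mono k (w - v) = mono k w := by
  rw [mono, mono, monomial_mul, add_tsub_cancel_of_le h, mul_one, mono]

variable [Fintype V]

theorem boundary_dehomogenize (f : Chains k n Δ (t + 1)) :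
    boundary (dehomogenize label f) = dehomogenize label (differential k Δ label t f) := by
  induction f using Finsupp.induction_linear with
  | zero => rw [map_zero, map_zero, map_zero, boundary_zero]
  | add f g hf hg => rw [map_add, boundary_add, hf, hg, map_add, map_add]
  | single σ c =>
    rw [dehomogenize_single, boundary_single, differential, Finsupp.linearCombination_single,
      map_smul, map_sum, Finset.smul_sum, ← Finset.sum_attach]
    refine Finset.sum_congr rfl fun v _ => ?_
    have hle : faceLabel label (σ.1.erase v.1) ≤ faceLabel label σ.1 :=
      Finset.sup_mono (Finset.erase_subset _ _)
    rw [dehomogenize_single, ← Pi.single_smul, vertexSign_eq_pow]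
    congr 1
    change _ = c * (mono k (faceLabel label (σ.1.erase v.1)) * _)
    rw [← mono_mul_mono_sub hle]
    ring

theorem boundary_dehomogenize_empty (f : Chains k n Δ 0) :
    boundary (dehomogenize label f) ∅ = augmentation k Δ label f := by
  induction f using Finsupp.induction_linear with
  | zero => rw [map_zero, map_zero, boundary_zero, Pi.zero_apply]
  | add f g hf hg => rw [map_add, boundary_add, map_add, Pi.add_apply, hf, hg]
  | single σ c =>
    obtain ⟨v, hv⟩ := Finset.card_eq_one.mp σ.2.2
    rw [dehomogenize_single, boundary_single, augmentation, Finsupp.linearCombination_single, hv,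
      Finset.sum_singleton, Finset.erase_singleton, Pi.single_eq_same, smul_eq_mul]
    simp [vertexSign, mul_comm]

theorem boundary_dehomogenize_eq_zero {f : Chains k n Δ 0} (h : augmentation k Δ label f = 0) :
    boundary (dehomogenize label f) = 0 := by
  funext τ
  by_contra hne
  obtain ⟨v, hv, hv'⟩ := exists_of_boundary_ne_zero hne
  have hc := (mem_of_dehomogenize_ne_zero hv').2
  rw [Finset.card_insert_of_notMem hv] at hc
  obtain rfl : τ = ∅ := Finset.card_eq_zero.mp (by omega)
  exact hne ((boundary_dehomogenize_empty f).trans h)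

theorem coeff_boundary (w : Fin n →₀ ℕ) (f : Finset V → MvPolynomial (Fin n) k)
    (τ : Finset V) :
    coeff w (boundary f τ) = boundary (fun σ => coeff w (f σ)) τ := by
  rw [boundary, boundary, coeff_sum]
  refine Finset.sum_congr rfl fun v _ => ?_
  rw [vertexSign_eq_pow, vertexSign_eq_pow]
  rcases neg_one_pow_eq_or (MvPolynomial (Fin n) k) (τ.filter (· < v)).card with h | h <;>
  rcases Nat.even_or_odd (τ.filter (· < v)).card with h' | h' <;>
  simp [h'.neg_one_pow]

/-- The faces of `Δ`, and the empty set, whose label divides the monomial with exponent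
vector `w`. -/
def boundedFaces (Δ : PreAbstractSimplicialComplex V) (label : V → (Fin n →₀ ℕ))
    (w : Fin n →₀ ℕ) : Set (Finset V) :=
  {σ | (σ = ∅ ∨ σ ∈ Δ.faces) ∧ faceLabel label σ ≤ w}

/-- The coefficients of a fixed monomial `x ^ w` in the dehomogenized cycle form a cycle over `k` on
the faces with label at most `w`. Fill it there, divide by the labels, and sum over the finitely
many `w` that occur. -/
theorem exists_differential_eq
    (hac : ∀ w, (∃ σ ∈ Δ.faces, faceLabel label σ ≤ w) →
      IsAcyclicFamily k (boundedFaces Δ label w))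
    (f : Chains k n Δ t) (hf : boundary (dehomogenize label f) = 0) :
    ∃ g, differential k Δ label t g = f := by
  classical
  set F := dehomogenize label f with hF
  have hcoeff : ∀ {w σ}, coeff w (F σ) ≠ 0 →
      (σ ∈ Δ.faces ∧ σ.card = t + 1) ∧ faceLabel label σ ≤ w := by
    intro w σ h
    have hσ := mem_of_dehomogenize_ne_zero (label := label) (f := f) (σ := σ) fun h0 => h (by
      rw [hF, h0, coeff_zero])
    refine ⟨hσ, ?_⟩
    rw [hF, dehomogenize_face f ⟨σ, hσ⟩, mono, coeff_monomial_mul'] at h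
    by_contra hle
    exact h (if_neg hle)
  have key : ∀ w, ∃ g : Finset V → k, (∀ σ, g σ ≠ 0 →
      σ ∈ boundedFaces Δ label w ∧ σ.card = t + 1 + 1) ∧
        boundary g = fun σ => coeff w (F σ) := by
    intro w
    -- Acyclicity is available only when `w` bounds a face; for other `w` all coefficients vanish
    -- and the zero filling works.
    by_cases h : ∀ σ, coeff w (F σ) = 0
    · refine ⟨0, fun σ hσ => absurd rfl hσ, ?_⟩
      rw [boundary_zero]
      funext σ
      exact (h σ).symm
    · push Not at h
      obtain ⟨σ, hσ⟩ := h
      refine hac w ⟨σ, (hcoeff hσ).1.1, (hcoeff hσ).2⟩ (t + 1) _ (fun σ hσ => ?_) ?_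
      · have := hcoeff hσ
        exact ⟨⟨Or.inr this.1.1, this.2⟩, this.1.2⟩
      · funext τ
        rw [← coeff_boundary, hf, Pi.zero_apply, coeff_zero, Pi.zero_apply]
  choose g hg hgF using key
  set T : Finset (Fin n →₀ ℕ) := Finset.univ.biUnion fun σ => (F σ).support with hT
  let G : Chains k n Δ (t + 1) := Finsupp.equivFunOnFinite.symm fun σ =>
    ∑ w ∈ T, monomial (w - faceLabel label σ.1) (g w σ.1)
  have hexp : ∀ {σ}, σ ∈ Δ.faces ∧ σ.card = t + 1 + 1 →
      dehomogenize label G σ = ∑ w ∈ T, monomial w (g w σ) := by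
    intro σ hσ
    rw [dehomogenize_face G ⟨σ, hσ⟩]
    change _ * ∑ w ∈ T, _ = _
    rw [Finset.mul_sum]
    refine Finset.sum_congr rfl fun w _ => ?_
    by_cases h0 : g w σ = 0
    · simp [h0]
    -- The truncated exponent `w - M_σ` is a true quotient because the filling is supported on faces
    -- whose label divides `x ^ w`.
    · rw [mono, monomial_mul, one_mul, add_tsub_cancel_of_le (hg w σ h0).1.2]
  have hG : ∀ w ∈ T, ∀ σ, coeff w (dehomogenize label G σ) = g w σ := by
    intro w hw σ
    by_cases hσ : σ ∈ Δ.faces ∧ σ.card = t + 1 + 1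
    · rw [hexp hσ, coeff_sum, Finset.sum_eq_single_of_mem w hw, coeff_monomial, if_pos rfl]
      intro w' _ hne
      rw [coeff_monomial, if_neg hne]
    · have h1 : dehomogenize label G σ = 0 := by
        by_contra h
        exact hσ (mem_of_dehomogenize_ne_zero h)
      rw [h1, coeff_zero]
      by_contra h
      obtain ⟨h2, h3⟩ := hg w σ (Ne.symm h)
      rcases h2.1 with rfl | h2
      · simp at h3
      · exact hσ ⟨h2, h3⟩
  have hG' : ∀ w ∉ T, ∀ σ, coeff w (dehomogenize label G σ) = 0 := by
    intro w hw σ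
    by_contra hne
    have hσ := mem_of_dehomogenize_ne_zero (label := label) (f := G) (σ := σ) fun h0 => hne (by
      rw [h0, coeff_zero])
    refine hne ?_
    rw [hexp hσ, coeff_sum]
    refine Finset.sum_eq_zero fun w' hw' => ?_
    rw [coeff_monomial, if_neg]
    rintro rfl
    exact hw hw'
  refine ⟨G, dehomogenize_injective (label := label) ?_⟩
  rw [← boundary_dehomogenize]
  funext τ
  ext w
  rw [coeff_boundary]
  by_cases hw : w ∈ T
  · rw [funext (hG w hw), hgF]
  · rw [funext (hG' w hw)]
    have h0 : coeff w (F τ) = 0 := by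
      by_contra h
      exact hw (Finset.mem_biUnion.mpr ⟨τ, Finset.mem_univ _, mem_support_iff.mpr h⟩)
    exact (congrFun boundary_zero τ).trans h0.symm

-- Multiplication by the face labels absorbs the degree shifts of the basis elements, so all entries
-- then have the same degree `w`.
omit [LinearOrder V] [Fintype V] in
theorem isMultihomogeneous_iff {w : Fin n →₀ ℕ} {f : Chains k n Δ t} :
    IsMultihomogeneous k label w f ↔
      ∀ σ, ∀ e, coeff e (dehomogenize label f σ) ≠ 0 → e = w := by
  constructor
  · intro h σ e he
    have hσ := mem_of_dehomogenize_ne_zero (label := label) (f := f) (σ := σ) fun h0 => he (by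
      rw [h0, coeff_zero])
    rw [dehomogenize_face f ⟨σ, hσ⟩, mono, coeff_monomial_mul'] at he
    split_ifs at he with hle
    · rw [one_mul] at he
      rw [← h ⟨σ, hσ⟩ _ (mem_support_iff.mpr he)]
      exact (tsub_add_cancel_of_le hle).symm
    · exact absurd rfl he
  · intro h σ e he
    refine h σ.1 _ ?_
    rw [dehomogenize_face, mono, add_comm, coeff_monomial_mul, one_mul]
    exact mem_support_iff.mp he

theorem eq_of_coeff_boundary_ne_zero {w : Fin n →₀ ℕ} {f : Chains k n Δ t}
    (h : IsMultihomogeneous k label w f) {τ : Finset V} {e : Fin n →₀ ℕ}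
    (he : coeff e (boundary (dehomogenize label f) τ) ≠ 0) : e = w := by
  rw [coeff_boundary] at he
  obtain ⟨v, -, hv⟩ := exists_of_boundary_ne_zero he
  exact isMultihomogeneous_iff.mp h _ e hv

omit [LinearOrder V] [Fintype V] in
theorem range_augmentation :
    LinearMap.range (augmentation k Δ label) =
      Ideal.span {p | ∃ v, {v} ∈ Δ.faces ∧ p = mono k (label v)} := by
  rw [augmentation, Finsupp.range_linearCombination]
  congr 1
  ext p
  constructor
  · rintro ⟨σ, rfl⟩
    obtain ⟨v, hv⟩ := Finset.card_eq_one.mp σ.2.2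
    refine ⟨v, hv ▸ σ.2.1, ?_⟩
    simp [hv, faceLabel]
  · rintro ⟨v, hv, rfl⟩
    exact ⟨⟨{v}, hv, by simp⟩, by simp [faceLabel]⟩

theorem supportsFreeResolution_of_isAcyclicFamily {I : Ideal (MvPolynomial (Fin n) k)}
    (hI : I = Ideal.span {p | ∃ v, {v} ∈ Δ.faces ∧ p = mono k (label v)})
    (hac : ∀ w, (∃ σ ∈ Δ.faces, faceLabel label σ ≤ w) →
      IsAcyclicFamily k (boundedFaces Δ label w)) :
    SupportsFreeResolution k Δ label I where
  isFreeResolution :=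
    { free := fun t => inferInstance
      finite := fun t => inferInstance
      bounded := by
        refine ⟨Fintype.card V, fun t ht => ?_⟩
        have : IsEmpty (FaceOfDim Δ t) := ⟨fun σ => by
          have := Finset.card_le_univ σ.1
          rw [σ.2.2] at this
          omega⟩
        infer_instance
      exact_succ := fun t f => by
        constructor
        · intro h
          exact exists_differential_eq hac f (by rw [boundary_dehomogenize, h, map_zero])
        · rintro ⟨g, rfl⟩
          apply dehomogenize_injective (label := label)
          rw [← boundary_dehomogenize, ← boundary_dehomogenize, boundary_boundary, map_zero]
      exact_zero := fun f => by
        constructor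
        · intro h
          exact exists_differential_eq hac f (boundary_dehomogenize_eq_zero h)
        · rintro ⟨g, rfl⟩
          rw [← boundary_dehomogenize_empty, ← boundary_dehomogenize, boundary_boundary,
            Pi.zero_apply]
      range_eq := by rw [range_augmentation, hI] }
  differential_homogeneous t w f hf := by
    rw [isMultihomogeneous_iff]
    intro σ e he
    rw [← boundary_dehomogenize] at he
    exact eq_of_coeff_boundary_ne_zero hf he
  augmentation_homogeneous w f hf e he := by
    rw [← boundary_dehomogenize_empty, mem_support_iff] at he
    exact eq_of_coeff_boundary_ne_zero hf he

end Dehomogenization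

/-! ### Exchange arguments on exponent vectors and acyclicity of the bounded subcomplexes. -/

section Combinatorics

variable {n q r : ℕ}

instance : Finite (Points r q) := by
  refine Finite.of_injective
    (fun (a : Points r q) (i : Fin q) => (⟨a.coord i, ?_⟩ : Fin (r + 1))) fun a b h => ?_
  · have := Finset.single_le_sum (f := a.coord) (fun _ _ => Nat.zero_le _) (Finset.mem_univ i)
    rw [a.sum_coord] at this
    omega
  · ext i
    exact congrArg Fin.val (congrFun h i)

noncomputable instance : Fintype (Points r q) := Fintype.ofFinite _

theorem Points.coord_add_le (a : Points r q) {i j : Fin q} (hij : i ≠ j) :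
    a.coord i + a.coord j ≤ r := by
  have := Finset.sum_le_univ_sum_of_nonneg (s := {i, j}) (f := a.coord) fun _ => Nat.zero_le _
  rwa [Finset.sum_pair hij, a.sum_coord] at this

theorem Points.coord_le (a : Points r q) (i : Fin q) : a.coord i ≤ r := by
  have := Finset.single_le_sum (f := a.coord) (fun _ _ => Nat.zero_le _) (Finset.mem_univ i)
  rwa [a.sum_coord] at this

/-- A point other than `a = r eᵢ` has a nonzero coordinate away from `i`. -/
theorem Points.exists_one_le_coord {a b : Points r q} {i : Fin q} (ha : a.coord i = r)
    (hab : b ≠ a) : ∃ j, j ≠ i ∧ 1 ≤ b.coord j := by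
  by_contra! h
  apply hab
  have hb : b.coord i = r := by
    refine (Finset.sum_eq_single_of_mem i (Finset.mem_univ i) fun j _ hj => ?_).symm.trans
      b.sum_coord
    have := h j hj
    omega
  ext j
  by_cases hj : j = i
  · rw [hj, ha, hb]
  · have := h j hj
    have := a.coord_add_le hj
    omega

/-- Move `d` units from the coordinate `i` to the coordinate `j`. -/
def Points.move (a : Points r q) (i j : Fin q) (d : ℕ) (hd : d ≤ a.coord i) : Points r q where
  coord l := (a.coord l - if l = i then d else 0) + if l = j then d else 0
  sum_coord := by
    have h : ∀ l, ((a.coord l - if l = i then d else 0) + if l = j then d else 0) +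
        (if l = i then d else 0) = a.coord l + if l = j then d else 0 := by
      intro l
      by_cases hl : l = i
      · subst hl
        simp only [if_true]
        omega
      · simp [hl]
    have h2 := Finset.sum_congr (rfl : (Finset.univ : Finset (Fin q)) = _) fun l _ => h l
    simp only [Finset.sum_add_distrib] at h2
    simp only [Finset.sum_ite_eq', Finset.mem_univ, if_true, a.sum_coord] at h2
    rw [Finset.sum_add_distrib]
    simp only [Finset.sum_ite_eq', Finset.mem_univ, if_true]
    omega

theorem Points.move_coord_source (a : Points r q) {i j : Fin q} {d : ℕ} (hd : d ≤ a.coord i)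
    (hij : i ≠ j) : (a.move i j d hd).coord i = a.coord i - d := by
  simp [Points.move, hij]

variable (m : Fin q → (Fin n →₀ ℕ))

theorem powerLabel_apply (a : Points r q) (x : Fin n) :
    powerLabel m a x = ∑ i, a.coord i * m i x := by
  simp [powerLabel, Finsupp.finsetSum_apply]

theorem powerLabel_move_apply (a : Points r q) {i j : Fin q} {d : ℕ} (hd : d ≤ a.coord i)
    (x : Fin n) :
    powerLabel m (a.move i j d hd) x + d * m i x = powerLabel m a x + d * m j x := by
  have h : ∀ l, (a.move i j d hd).coord l * m l x + (if l = i then d * m l x else 0) =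
      a.coord l * m l x + if l = j then d * m l x else 0 := by
    intro l
    have h' : (a.move i j d hd).coord l + (if l = i then d else 0) =
        a.coord l + if l = j then d else 0 := by
      simp only [Points.move]
      by_cases hl : l = i
      · subst hl
        simp only [if_true]
        omega
      · simp [hl]
    have := congrArg (· * m l x) h'
    simpa only [add_mul, ite_mul, zero_mul] using this
  have h2 := Finset.sum_congr (rfl : (Finset.univ : Finset (Fin q)) = _) fun l _ => h l
  simp only [Finset.sum_add_distrib] at h2
  simp only [Finset.sum_ite_eq', Finset.mem_univ, if_true] at h2
  rw [powerLabel_apply, powerLabel_apply, h2]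

variable {m}

theorem coord_mul_le_powerLabel (a : Points r q) (i : Fin q) (x : Fin n) :
    a.coord i * m i x ≤ powerLabel m a x := by
  rw [powerLabel_apply]
  exact Finset.single_le_sum (f := fun i => a.coord i * m i x) (fun _ _ => Nat.zero_le _)
    (Finset.mem_univ i)

theorem powerLabel_add_coord_le (hm : ∀ i, IsSquarefreeMonomial (m i)) (a : Points r q)
    {i : Fin q} {x : Fin n} (hx : m i x = 0) : powerLabel m a x + a.coord i ≤ r := by
  rw [powerLabel_apply]
  conv_rhs => rw [← a.sum_coord]
  rw [← Finset.sum_erase_add _ _ (Finset.mem_univ i),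
    ← Finset.sum_erase_add _ a.coord (Finset.mem_univ i), hx, mul_zero, add_zero]
  exact Nat.add_le_add_right
    (Finset.sum_le_sum fun l _ => mul_le_of_le_one_right (Nat.zero_le _) (hm l x)) _

theorem exists_eq_zero_and_eq_one (hm : ∀ i, IsSquarefreeMonomial (m i))
    {i j : Fin q} (h : ¬ m j ≤ m i) : ∃ x, m i x = 0 ∧ m j x = 1 := by
  rw [Finsupp.le_def] at h
  push Not at h
  obtain ⟨x, hx⟩ := h
  have := hm j x
  exact ⟨x, by omega, by omega⟩

variable (hm : ∀ i, IsSquarefreeMonomial (m i)) (hanti : ∀ i j, i ≠ j → ¬ m i ≤ m j)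
  {N : Set (Points r q)} (hN : ∀ a : Points r q, ∃ c ∈ N, powerLabel m c ≤ powerLabel m a)

include hm in
/-- Moving `d` units from `i` to `j` in `a` stays below the lcm of the labels of `a` and `b`, if
what is then left outside the coordinate `i` is at most `bⱼ`. -/
theorem powerLabel_move_le_sup (a b : Points r q) {i j : Fin q} (hij : i ≠ j) {d : ℕ}
    (hd : d ≤ a.coord i) (hb : r + d ≤ a.coord i + b.coord j) :
    powerLabel m (a.move i j d hd) ≤ powerLabel m a ⊔ powerLabel m b := by
  intro x
  rw [Finsupp.sup_apply, le_sup_iff]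
  have hmove := powerLabel_move_apply m a (j := j) hd x
  -- Only a variable dividing `mⱼ` but not `mᵢ` gains exponent in the move; its new exponent is at
  -- most `r - (aᵢ - d) ≤ bⱼ`, which `m ^ b` already reaches.
  by_cases h : m i x = 0 ∧ m j x = 1
  · right
    have h1 := powerLabel_add_coord_le hm (a.move i j d hd) h.1
    rw [a.move_coord_source hd hij] at h1
    have h2 := coord_mul_le_powerLabel (m := m) b j x
    rw [h.2] at h2
    omega
  · left
    have : m j x ≤ m i x := by
      have := hm j x
      omega
    have := Nat.mul_le_mul_left d this
    omega

theorem le_two_mul_half : r ≤ 2 * half r := by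
  unfold half
  omega

theorem half_lt (hr : 2 ≤ r) : half r < r := by
  unfold half
  omega

include hm hanti hN in
/-- If two points whose labels divide `w` have large coordinates in different places, then the
base contains a point of `N` whose label divides `w`. -/
theorem exists_mem_base (w : Fin n →₀ ℕ) (a b : Points r q) (ha : a ∈ N) (hb : b ∈ N)
    {i j : Fin q} (hij : i ≠ j) (hai : half r < a.coord i) (hbj : half r < b.coord j)
    (hw : powerLabel m a ⊔ powerLabel m b = w) :
    ∃ c ∈ N, c ∈ base r q ∧ powerLabel m c ≤ w := by
  induction w using WellFoundedLT.induction generalizing a b i j with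
  | _ w ih =>
  subst hw
  have hr := le_two_mul_half (r := r)
  -- Lower `aᵢ` to exactly `s`. The move is admissible because `r - s ≤ s < bⱼ`. If the
  -- representative below the result is not in the base, it replaces `a` or `b`, and the lcm
  -- strictly drops.
  have hd : a.coord i - half r ≤ a.coord i := Nat.sub_le _ _
  set c := a.move i j _ hd with hc
  have hcle : powerLabel m c ≤ powerLabel m a ⊔ powerLabel m b :=
    powerLabel_move_le_sup hm a b hij hd (by omega)
  have hci : c.coord i = half r := by
    rw [hc, a.move_coord_source hd hij]
    omega
  obtain ⟨c', hc'N, hc'⟩ := hN c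
  by_cases hbase : c' ∈ base r q
  · exact ⟨c', hc'N, hbase, hc'.trans hcle⟩
  obtain ⟨l, hl⟩ : ∃ l, half r < c'.coord l := by
    simpa [base] using hbase
  by_cases hil : i = l
  · subst hil
    have hlt : powerLabel m c' ⊔ powerLabel m b < powerLabel m a ⊔ powerLabel m b := by
      refine lt_of_le_of_ne (sup_le (hc'.trans hcle) le_sup_right) fun heq => ?_
      -- At `x` the move removes `d ≥ 1` from the exponent of `m ^ a`, which is at least `aᵢ > s`,
      -- while `m ^ b` has exponent at most `r - bⱼ < s`.
      obtain ⟨x, hxj, hxi⟩ := exists_eq_zero_and_eq_one hm (hanti i j hij)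
      have h1 := DFunLike.congr_fun heq x
      have h2 := powerLabel_move_apply m a (j := j) hd x
      have h3 := powerLabel_add_coord_le hm b hxj
      have h4 := coord_mul_le_powerLabel (m := m) a i x
      have h5 := hc' x
      rw [← hc, hxi, hxj] at h2
      rw [hxi] at h4
      rw [Finsupp.sup_apply, Finsupp.sup_apply] at h1
      omega
    obtain ⟨e, heN, heB, he⟩ := ih _ hlt c' b hc'N hb hij hl hbj rfl
    exact ⟨e, heN, heB, he.trans hlt.le⟩
  · have hlt : powerLabel m a ⊔ powerLabel m c' < powerLabel m a ⊔ powerLabel m b := by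
      refine lt_of_le_of_ne (sup_le le_sup_left (hc'.trans hcle)) fun heq => ?_
      -- At `x` both `m ^ a` and `m ^ c'` have exponent at most `r - s ≤ s`, while `m ^ b` has at
      -- least `bⱼ > s`.
      obtain ⟨x, hxi, hxj⟩ := exists_eq_zero_and_eq_one hm (hanti j i hij.symm)
      have h1 := DFunLike.congr_fun heq x
      have h2 := powerLabel_add_coord_le hm a hxi
      have h3 := powerLabel_add_coord_le hm c hxi
      have h4 := coord_mul_le_powerLabel (m := m) b j x
      have h5 := hc' x
      rw [hxj] at h4
      rw [Finsupp.sup_apply, Finsupp.sup_apply] at h1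
      omega
    obtain ⟨e, heN, heB, he⟩ := ih _ hlt a c' ha hc'N hil hai hl rfl
    exact ⟨e, heN, heB, he.trans hlt.le⟩

include hm hanti hN in
/-- If the labels of `a = r eᵢ` and of a further point divide `w`, then `N` contains a point
`u ≠ a` with `uᵢ ≥ r - 1` whose label divides `w`. -/
theorem exists_mem_secondLayer {w : Fin n →₀ ℕ} {a b : Points r q} {i : Fin q} (hr : 1 ≤ r)
    (hai : a.coord i = r) (hba : b ≠ a) (ha : powerLabel m a ≤ w) (hb : powerLabel m b ≤ w) :
    ∃ u ∈ N, u ∈ secondLayer r q i ∧ powerLabel m u ≤ w ∧ u ≠ a := by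
  have hd : 1 ≤ a.coord i := by omega
  have hmove : ∀ c : Points r q, powerLabel m c ≤ w → ∀ j, j ≠ i → 1 ≤ c.coord j →
      powerLabel m (a.move i j 1 hd) ≤ w := fun c hc j hj hcj =>
    (powerLabel_move_le_sup hm a c hj.symm hd (by omega)).trans (sup_le ha hc)
  let J : Set (Fin q) := {j | j ≠ i ∧ powerLabel m (a.move i j 1 hd) ≤ w}
  have hJ : J.Nonempty := by
    obtain ⟨j, hj, hbj⟩ := Points.exists_one_le_coord hai hba
    exact ⟨j, hj, hmove b hb j hj hbj⟩
  -- Taking `lcm(mᵢ, mⱼ)` minimal forces every other generator occurring in `m ^ u` to agree with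
  -- `mⱼ` outside the variables of `mᵢ`.
  obtain ⟨j, ⟨hji, hjw⟩, hmin⟩ :=
    (InvImage.wf (fun j => m j ⊔ m i) wellFounded_lt).has_min J hJ
  obtain ⟨u, huN, hu⟩ := hN (a.move i j 1 hd)
  have huw := hu.trans hjw
  have hx0 : ∀ x, m i x = 0 → powerLabel m u x ≤ m j x := by
    intro x hx
    have h1 := powerLabel_move_apply m a (j := j) hd x
    have h2 := powerLabel_add_coord_le hm a hx
    have h3 := hu x
    rw [hx] at h1
    omega
  have hua : u ≠ a := by
    rintro rfl
    obtain ⟨x, hxj, hxi⟩ := exists_eq_zero_and_eq_one hm (hanti i j hji.symm)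
    have h1 := powerLabel_move_apply m u (j := j) hd x
    have h3 := hu x
    rw [hxi, hxj] at h1
    omega
  have hmeq : ∀ l, l ≠ i → 1 ≤ u.coord l → ∀ x, m i x = 0 → m l x = m j x := by
    intro l hl hul x hx
    have hle : m l ⊔ m i ≤ m j ⊔ m i := by
      intro y
      rw [Finsupp.sup_apply, Finsupp.sup_apply]
      have h1 := coord_mul_le_powerLabel (m := m) u l y
      have h2 := Nat.le_mul_of_pos_left (m l y) hul
      have h3 := hx0 y
      have h4 := hm l y
      omega
    have heq : m l ⊔ m i = m j ⊔ m i := by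
      by_contra hne
      exact hmin l ⟨hl, hmove u huw l hl hul⟩ (lt_of_le_of_ne hle hne)
    have := DFunLike.congr_fun heq x
    simpa [hx] using this
  obtain ⟨l, hl, hul⟩ := Points.exists_one_le_coord hai hua
  obtain ⟨x, hxi, hxl⟩ := exists_eq_zero_and_eq_one hm (hanti l i hl)
  have hxj : m j x = 1 := (hmeq l hl hul x hxi).symm.trans hxl
  refine ⟨u, huN, ?_, huw, hua⟩
  -- The variable `x` divides every `m l` with `l ≠ i` occurring in `u`, so its exponent in `m ^ u`
  -- is the total of `u` outside `i`; by `hx0` this is at most `1`.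
  have hsum : ∑ l, u.coord l ≤ ∑ l, ((if l = i then u.coord i else 0) + u.coord l * m l x) := by
    refine Finset.sum_le_sum fun l _ => ?_
    by_cases hli : l = i
    · simp [hli]
    · rcases Nat.eq_zero_or_pos (u.coord l) with h | h
      · simp [h]
      · rw [hmeq l hli h x hxi, hxj, mul_one]
        exact Nat.le_add_left _ _
  rw [Finset.sum_add_distrib, u.sum_coord, ← powerLabel_apply] at hsum
  simp only [Finset.sum_ite_eq', Finset.mem_univ, if_true] at hsum
  have := hx0 x hxi
  change r - 1 ≤ u.coord i
  omega

/-- A point `r eᵢ`, where `r ≥ 2`. These are the points that lie in no `Fᵢ`. -/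
def IsCorner (a : Points r q) : Prop := 2 ≤ r ∧ ∃ i, a.coord i = r

/-- Since `r ≤ 2s`, at most one coordinate can exceed `s`. For `r = 1` the bound `max (r - 1) s` is
`s = 1`, which no coordinate exceeds. -/
theorem mem_firstLayer_of_half_lt {a : Points r q} {i : Fin q} (ha : ¬ IsCorner a)
    (hi : half r < a.coord i) : a ∈ firstLayer r q i := by
  have hr := le_two_mul_half (r := r)
  refine ⟨?_, fun j hj => ?_⟩
  · have h1 := a.coord_le i
    by_cases h2 : 2 ≤ r
    · have h3 : a.coord i ≠ r := fun h => ha ⟨h2, i, h⟩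
      exact le_max_of_le_left (by omega)
    · unfold half at *
      exact le_max_of_le_right (by omega)
  · have := a.coord_add_le hj
    omega

theorem mem_firstLayer_of_mem_base {a : Points r q} (ha : a ∈ base r q) (i : Fin q) :
    a ∈ firstLayer r q i :=
  ⟨le_max_of_le_right (ha i), fun j _ => ha j⟩

theorem not_isCorner_of_mem_base {a : Points r q} (ha : a ∈ base r q) : ¬ IsCorner a := by
  rintro ⟨hr, i, hi⟩
  have := ha i
  have := half_lt hr
  omega

theorem mem_firstLayer_of_mem_secondLayer (hr : 1 ≤ r) {a : Points r q} {i : Fin q}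
    (ha : ¬ IsCorner a) (hi : a ∈ secondLayer r q i) : a ∈ firstLayer r q i := by
  by_cases h : half r < a.coord i
  · exact mem_firstLayer_of_half_lt ha h
  · refine mem_firstLayer_of_mem_base (fun j => ?_) i
    by_cases hj : j = i
    · rw [hj]
      omega
    · have h1 := a.coord_add_le hj
      have h2 : r - 1 ≤ a.coord i := hi
      have h3 : 1 ≤ half r := by
        unfold half
        omega
      omega

/-- `Gᵢ` is the only facet through the corner `r eᵢ`; this is what makes corners dominated. -/
theorem subset_secondLayer_of_coord_eq {σ : Finset (Points r q)} (hσ : σ ∈ (complexL r q).faces)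
    {a : Points r q} {i : Fin q} (hr : 2 ≤ r) (ha : a.coord i = r) (haσ : a ∈ σ) :
    (σ : Set (Points r q)) ⊆ secondLayer r q i := by
  have hlt := half_lt hr
  obtain ⟨-, j, h | h⟩ := hσ
  · exfalso
    have h1 := h haσ
    by_cases hij : i = j
    · subst hij
      have h2 := h1.1
      rw [ha] at h2
      rcases le_max_iff.mp h2 with h3 | h3 <;> omega
    · have := h1.2 i hij
      omega
  · by_cases hij : i = j
    · rwa [hij]
    · exfalso
      have h1 : r - 1 ≤ a.coord j := h haσ
      have := a.coord_add_le hij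
      omega

theorem exists_singleton_mem_faces (hq : 1 ≤ q) (a : Points r q) :
    {a} ∈ (complexL r q).faces := by
  refine ⟨Finset.singleton_nonempty a, ?_⟩
  simp only [Finset.coe_singleton, Set.singleton_subset_iff]
  by_cases hc : IsCorner a
  · obtain ⟨-, i, hi⟩ := hc
    exact ⟨i, Or.inr (by change r - 1 ≤ a.coord i; omega)⟩
  · by_cases h : ∃ i, half r < a.coord i
    · obtain ⟨i, hi⟩ := h
      exact ⟨i, Or.inl (mem_firstLayer_of_half_lt hc hi)⟩
    · push Not at h
      exact ⟨⟨0, hq⟩, Or.inl (mem_firstLayer_of_mem_base h _)⟩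

include hm hanti hN in
theorem isAcyclicFamily_boundedFaces [LinearOrder (Points r q)] (A : Type*) [CommRing A]
    (hq : 1 ≤ q) (hr : 1 ≤ r) (w : Fin n →₀ ℕ) (hw : ∃ a ∈ N, powerLabel m a ≤ w) :
    IsAcyclicFamily A
      (boundedFaces (inducedSubcomplex (complexL r q) N) (powerLabel m) w) := by
  classical
  set K := boundedFaces (inducedSubcomplex (complexL r q) N) (powerLabel m) w with hKdef
  have hmem : ∀ {σ}, σ ∈ K ↔ (σ = ∅ ∨ σ ∈ (complexL r q).faces) ∧
      ∀ a ∈ σ, a ∈ N ∧ powerLabel m a ≤ w := by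
    intro σ
    simp only [hKdef, boundedFaces, faceLabel, Set.mem_ofPred_eq, Finset.sup_le_iff]
    constructor
    · rintro ⟨rfl | h, h'⟩
      · simp
      · exact ⟨Or.inr h.1, fun a ha => ⟨h.2 ha, h' a ha⟩⟩
    · rintro ⟨h | h, h'⟩
      · exact ⟨Or.inl h, fun a ha => (h' a ha).2⟩
      · exact ⟨Or.inr ⟨h, fun a ha => (h' a ha).1⟩, fun a ha => (h' a ha).2⟩
  have hlower : IsLowerSet K := by
    intro σ τ hτ hσ
    rw [hmem] at hσ ⊢
    refine ⟨?_, fun a ha => hσ.2 a (hτ ha)⟩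
    rcases τ.eq_empty_or_nonempty with h | h
    · exact Or.inl h
    · rcases hσ.1 with rfl | h'
      · exact absurd (Finset.subset_empty.mp hτ) h.ne_empty
      · exact Or.inr (((complexL r q).isRelLowerSet_faces h').2 hτ h)
  obtain ⟨a₀, ha₀N, ha₀w⟩ := hw
  -- a single corner spans a simplex; otherwise the corners are dominated
  by_cases hone : IsCorner a₀ ∧ ∀ b ∈ N, powerLabel m b ≤ w → b = a₀
  · refine isAcyclicFamily_of_apex a₀ fun σ hσ => ?_
    have h1 : insert a₀ σ = {a₀} := by
      ext b
      rw [Finset.mem_insert, Finset.mem_singleton]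
      refine ⟨?_, Or.inl⟩
      rintro (h | h)
      · exact h
      · exact hone.2 b ((hmem.mp hσ).2 b h).1 ((hmem.mp hσ).2 b h).2
    rw [h1, hmem]
    refine ⟨Or.inr (exists_singleton_mem_faces hq a₀), fun a ha => ?_⟩
    rw [Finset.mem_singleton.mp ha]
    exact ⟨ha₀N, ha₀w⟩
  have hother : ∀ a, IsCorner a → powerLabel m a ≤ w →
      ∃ b ∈ N, powerLabel m b ≤ w ∧ b ≠ a := by
    intro a ha haw
    by_contra! h
    obtain rfl := h a₀ ha₀N ha₀w
    exact hone ⟨ha, h⟩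
  have hdom : ∀ a ∈ N, powerLabel m a ≤ w → ∀ i, 2 ≤ r → a.coord i = r →
      ∃ u ∈ N, powerLabel m u ≤ w ∧ ¬ IsCorner u ∧ u ∈ secondLayer r q i := by
    intro a haN haw i hr2 hai
    obtain ⟨b, hbN, hbw, hba⟩ := hother a ⟨hr2, i, hai⟩ haw
    obtain ⟨u, huN, hui, huw, hua⟩ := exists_mem_secondLayer hm hanti hN hr hai hba haw hbw
    refine ⟨u, huN, huw, ?_, hui⟩
    -- Besides `uᵢ ≥ r - 1 ≥ 1`, the point `u` has another nonzero coordinate, so none can equal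
    -- `r`.
    rintro ⟨-, j, hj⟩
    obtain ⟨l, hl, hul⟩ := Points.exists_one_le_coord hai hua
    have hui' : r - 1 ≤ u.coord i := hui
    by_cases hlj : l = j
    · subst hlj
      have := u.coord_add_le hl
      omega
    · have := u.coord_add_le hlj
      omega
  refine IsAcyclicFamily.of_forall_dominated hlower
    (Finset.univ.filter fun a => IsCorner a ∧ a ∈ N ∧ powerLabel m a ≤ w) ?_ ?_
  · intro a ha
    obtain ⟨-, ⟨hr2, i, hai⟩, haN, haw⟩ := Finset.mem_filter.mp ha
    obtain ⟨u, huN, huw, hu, hui⟩ := hdom a haN haw i hr2 hai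
    refine ⟨u, fun h => hu (Finset.mem_filter.mp h).2.1, fun σ hσ haσ => ?_⟩
    rw [hmem] at hσ ⊢
    have hface : σ ∈ (complexL r q).faces := by
      rcases hσ.1 with rfl | h
      · simp at haσ
      · exact h
    have hsub := subset_secondLayer_of_coord_eq hface hr2 hai haσ
    refine ⟨Or.inr ⟨Finset.insert_nonempty _ _, i, Or.inr ?_⟩, ?_⟩
    · rw [Finset.coe_insert]
      exact Set.insert_subset hui hsub
    · intro b hb
      rcases Finset.mem_insert.mp hb with rfl | hb
      · exact ⟨huN, huw⟩
      · exact hσ.2 b hb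
  -- the remaining complex is a cone
  obtain ⟨a₁, ha₁N, ha₁w, ha₁⟩ : ∃ a ∈ N, powerLabel m a ≤ w ∧ ¬ IsCorner a := by
    by_cases hc : IsCorner a₀
    · obtain ⟨hr2, i, hi⟩ := hc
      obtain ⟨u, huN, huw, hu, -⟩ := hdom a₀ ha₀N ha₀w i hr2 hi
      exact ⟨u, huN, huw, hu⟩
    · exact ⟨a₀, ha₀N, ha₀w, hc⟩
  -- The apex is a base vertex if there is one, and otherwise any non-corner, all of which then lie
  -- in one `Fᵢ`.
  obtain ⟨u, huN, huw, hu, hcone⟩ : ∃ u ∈ N, powerLabel m u ≤ w ∧ ¬ IsCorner u ∧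
      ∀ σ : Finset (Points r q), (∀ a ∈ σ, a ∈ N ∧ powerLabel m a ≤ w ∧ ¬ IsCorner a) →
        (σ = ∅ ∨ σ ∈ (complexL r q).faces) →
        ∃ i, ((insert u σ : Finset (Points r q)) : Set (Points r q)) ⊆ firstLayer r q i := by
    simp only [Finset.coe_insert, Set.insert_subset_iff]
    by_cases hB : ∃ u ∈ N, u ∈ base r q ∧ powerLabel m u ≤ w
    · obtain ⟨u, huN, huB, huw⟩ := hB
      refine ⟨u, huN, huw, not_isCorner_of_mem_base huB, fun σ hσ hσ' => ?_⟩
      rcases hσ' with rfl | ⟨-, i, h | h⟩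
      · exact ⟨⟨0, hq⟩, mem_firstLayer_of_mem_base huB _, by simp⟩
      · exact ⟨i, mem_firstLayer_of_mem_base huB _, h⟩
      · exact ⟨i, mem_firstLayer_of_mem_base huB _, fun a ha =>
          mem_firstLayer_of_mem_secondLayer hr (hσ a ha).2.2 (h ha)⟩
    · obtain ⟨i, hi⟩ : ∃ i, half r < a₁.coord i := by
        by_contra! h
        exact hB ⟨a₁, ha₁N, h, ha₁w⟩
      refine ⟨a₁, ha₁N, ha₁w, ha₁, fun σ hσ _ =>
        ⟨i, mem_firstLayer_of_half_lt ha₁ hi, fun a ha => ?_⟩⟩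
      obtain ⟨haN, haw, hac⟩ := hσ a ha
      obtain ⟨j, hj⟩ : ∃ j, half r < a.coord j := by
        by_contra! h
        exact hB ⟨a, haN, h, haw⟩
      by_cases hij : i = j
      · exact hij ▸ mem_firstLayer_of_half_lt hac hj
      · obtain ⟨c, hcN, hcB, hc⟩ :=
          exists_mem_base hm hanti hN _ a₁ a ha₁N haN hij hi hj rfl
        exact absurd ⟨c, hcN, hcB, hc.trans (sup_le ha₁w haw)⟩ hB
  refine isAcyclicFamily_of_apex u fun σ hσ => ?_
  obtain ⟨hσK, hσc⟩ := hσ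
  have hσ' := hmem.mp hσK
  obtain ⟨i, hi⟩ := hcone σ (fun a ha => ⟨(hσ'.2 a ha).1, (hσ'.2 a ha).2, fun hc =>
    hσc a (Finset.mem_filter.mpr ⟨Finset.mem_univ a, hc, hσ'.2 a ha⟩) ha⟩) hσ'.1
  refine ⟨hmem.mpr ⟨Or.inr ⟨Finset.insert_nonempty _ _, i, Or.inl hi⟩, fun a ha => ?_⟩,
    fun a ha ha' => ?_⟩
  · rcases Finset.mem_insert.mp ha with rfl | ha
    · exact ⟨huN, huw⟩
    · exact hσ'.2 a ha
  · rcases Finset.mem_insert.mp ha' with rfl | ha'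
    · exact hu (Finset.mem_filter.mp ha).2.1
    · exact hσc a ha ha'

end Combinatorics

/-! ### Generators of the power ideal and the choice of vertex sets. -/

section PowerIdeal

variable {k : Type*} [Field k] {n q r : ℕ} {m : Fin q → (Fin n →₀ ℕ)}

theorem mono_powerLabel (a : Points r q) :
    mono k (powerLabel m a) = ∏ i, mono k (m i) ^ a.coord i := by
  simp only [mono, powerLabel, monomial_sum_one, monomial_pow, one_pow]

theorem range_pow_eq {S : Type*} [CommRing S] (g : Fin q → S) :
    Set.range g ^ r = Set.range fun a : Points r q => ∏ i, g i ^ a.coord i := by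
  ext p
  rw [Set.mem_pow]
  constructor
  · rintro ⟨f, rfl⟩
    choose φ hφ using fun x => (f x).2
    -- The exponent of `g i` counts the factors among the `r` that equal `g i` under the chosen
    -- indexing `φ`.
    refine ⟨⟨fun i => (Finset.univ.filter fun x => φ x = i).card, ?_⟩, ?_⟩
    · rw [← Finset.card_eq_sum_card_fiberwise fun x _ => Finset.mem_univ (φ x), Finset.card_univ,
        Fintype.card_fin]
    · simp only [List.prod_ofFn, ← hφ]
      rw [← Finset.prod_fiberwise Finset.univ φ]
      refine Finset.prod_congr rfl fun i _ => ?_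
      rw [Finset.prod_congr rfl fun x hx => by rw [(Finset.mem_filter.mp hx).2],
        Finset.prod_const]
  · rintro ⟨a, rfl⟩
    rw [← Set.mem_pow]
    have h : ∏ i, g i ^ a.coord i ∈ ∏ i, Set.range g ^ a.coord i :=
      Set.finsetProd_mem_finsetProd _ _ _ fun i _ => Set.pow_mem_pow (Set.mem_range_self i)
    rwa [Finset.prod_pow_eq_pow_sum, a.sum_coord] at h

theorem pow_eq_span_powerLabel {I : Ideal (MvPolynomial (Fin n) k)}
    (hI : Ideal.span (Set.range fun i => mono k (m i)) = I) :
    I ^ r = Ideal.span (Set.range fun a : Points r q => mono k (powerLabel m a)) := by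
  simp only [mono_powerLabel]
  rw [← hI, ← range_pow_eq]
  exact Submodule.span_pow _ r

theorem not_le_of_isMinimallyGeneratedBy {I : Ideal (MvPolynomial (Fin n) k)}
    (hI : IsMinimallyGeneratedBy I fun i => mono k (m i)) (i j : Fin q) (hij : i ≠ j) :
    ¬ m i ≤ m j := by
  intro hle
  have h : Ideal.span ((fun i => mono k (m i)) '' {j}ᶜ) = I := by
    rw [← hI.1]
    refine le_antisymm (Ideal.span_mono (Set.image_subset_range _ _)) (Ideal.span_le.mpr ?_)
    rintro _ ⟨l, rfl⟩
    by_cases hl : l = j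
    · subst hl
      change mono k (m l) ∈ _
      rw [← mono_mul_mono_sub hle]
      exact Ideal.mul_mem_right _ _ (Ideal.subset_span ⟨i, hij, rfl⟩)
    · exact Ideal.subset_span ⟨l, hl, rfl⟩
  have := hI.2 _ h ▸ Set.mem_univ j
  exact this rfl

theorem supportsFreeResolution_inducedSubcomplex (hq : 1 ≤ q) (hr : 1 ≤ r)
    [LinearOrder (Points r q)] {I : Ideal (MvPolynomial (Fin n) k)}
    (hm : ∀ i, IsSquarefreeMonomial (m i))
    (hI : IsMinimallyGeneratedBy I fun i => mono k (m i)) {N : Set (Points r q)}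
    (hN : ∀ a : Points r q, ∃ c ∈ N, powerLabel m c ≤ powerLabel m a) :
    SupportsFreeResolution k (inducedSubcomplex (complexL r q) N) (powerLabel m) (I ^ r) := by
  refine supportsFreeResolution_of_isAcyclicFamily ?_ ?_
  · rw [pow_eq_span_powerLabel hI.1]
    refine le_antisymm (Ideal.span_le.mpr ?_) (Ideal.span_mono ?_)
    · rintro _ ⟨a, rfl⟩
      obtain ⟨c, hc, hca⟩ := hN a
      change mono k (powerLabel m a) ∈ _
      rw [← mono_mul_mono_sub hca]
      exact Ideal.mul_mem_right _ _
        (Ideal.subset_span ⟨c, ⟨exists_singleton_mem_faces hq c, by simpa using hc⟩, rfl⟩)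
    · rintro _ ⟨a, -, rfl⟩
      exact ⟨a, rfl⟩
  · rintro w ⟨σ, ⟨hσ, hσN⟩, hw⟩
    obtain ⟨a, ha⟩ := hσ.1
    exact isAcyclicFamily_boundedFaces hm (not_le_of_isMinimallyGeneratedBy hI) hN k hq hr w
      ⟨a, hσN ha, (Finset.le_sup ha).trans hw⟩

theorem inducedSubcomplex_univ {V : Type*} (Δ : PreAbstractSimplicialComplex V) :
    inducedSubcomplex Δ Set.univ = Δ := by
  ext σ
  exact and_iff_left (Set.subset_univ _)

/-- A representative with minimal label among those dividing `m ^ a` is never eliminated: a strictly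
smaller label contradicts minimality, an equal one the uniqueness of representatives. -/
theorem exists_mem_nonredundant_le {C : Set (Points r q)} (hC : IsRepresentativeSet m C)
    (a : Points r q) : ∃ c ∈ nonredundant m C, powerLabel m c ≤ powerLabel m a := by
  obtain ⟨c₀, ⟨hc₀, h₀⟩, -⟩ := hC.existsUnique a
  obtain ⟨c, ⟨hc, hca⟩, hmin⟩ := (InvImage.wf (powerLabel (r := r) m) wellFounded_lt).has_min
    {c | c ∈ C ∧ powerLabel m c ≤ powerLabel m a} ⟨c₀, hc₀, h₀.le⟩
  refine ⟨c, ⟨hc, ?_⟩, hca⟩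
  rintro ⟨c', hc', hne, hle⟩
  by_cases heq : powerLabel m c' = powerLabel m c
  · exact hne ((hC.existsUnique c).unique ⟨hc', heq⟩ ⟨hc, rfl⟩)
  · exact hmin c' ⟨hc', hle.trans hca⟩ (lt_of_le_of_ne hle heq)

end PowerIdeal

end PowerResolution

theorem theorem5p7 {k : Type*} [Field k] {n q r : ℕ} (hq : 1 ≤ q) (hr : 1 ≤ r)
    [LinearOrder (PowerResolution.Points r q)]
    (I : Ideal (MvPolynomial (Fin n) k)) (m : Fin q → (Fin n →₀ ℕ))
    (hm : ∀ i, PowerResolution.IsSquarefreeMonomial (m i))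
    (hI : PowerResolution.IsMinimallyGeneratedBy I (fun i => PowerResolution.mono k (m i))) :
    PowerResolution.SupportsFreeResolution k (PowerResolution.complexL r q)
        (PowerResolution.powerLabel m) (I ^ r) ∧
      ∀ C : Set (PowerResolution.Points r q), PowerResolution.IsRepresentativeSet m C →
        PowerResolution.SupportsFreeResolution k (PowerResolution.complexLOf m C)
          (PowerResolution.powerLabel m) (I ^ r) := by
  refine ⟨?_, fun C hC =>
    PowerResolution.supportsFreeResolution_inducedSubcomplex hq hr hm hI
      (PowerResolution.exists_mem_nonredundant_le hC)⟩
  rw [← PowerResolution.inducedSubcomplex_univ (PowerResolution.complexL r q)]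
  exact PowerResolution.supportsFreeResolution_inducedSubcomplex hq hr hm hI
    fun a => ⟨a, Set.mem_univ a, le_rfl⟩
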